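/- All Banach spaces are real. A Banach space $X$ is called SWKA (strongly weakly $\mathcal K$-analytic) if there is an upper semicontinuous map $F$ from $\mathbb N^{\mathbb N}$ to the nonempty weakly compact subsets of $X$ with $\bigcup_{\sigma} F(\sigma)=X$ such that every weakly compact $L\subseteq X$ is contained in $F(\sigma)$ for some $\sigma\in\mathbb N^{\mathbb N}$; here upper semicontinuous means that for every $\sigma$ and every weakly open $V\supseteq F(\sigma)$ there is a neighbourhood $W$ of $\sigma$ with $F(\tau)\subseteq V$ for all $\tau\in W$. If $X$ is a subspace of a Banach space $Z$, then $X$ is SWCG (strongly weakly compactly generated) with respect to $Z$ if there is a weakly compact $K\subseteq Z$ such that for every weakly compact $L\subseteq X$ and every $\varepsilon>0$ there is $n\in\mathbb N$, $n\ge 1$, with $L\subseteq nK+\varepsilon B_Z$; $X$ is SWCG if it is SWCG with respect to itself. A bounded set $M\subseteq X$ is $\varepsilon$-weakly relatively compact if $\overline{M}^{w^*}\subseteq X+\varepsilon B_{X^{**}}$ in $X^{**}$. The space $X$ has property (*) if there are sets $M_{n,p}\subseteq X$ ($n,p\in\mathbb N$, $p\ge 1$) such that each $M_{n,p}$ is $\frac1p$-weakly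 relatively compact and, for every $p$, every weakly compact subset of $X$ is contained in $M_{n,p}$ for some $n$. Theorem. The Banach space \[ X=\Big(\sum_{m=1}^\infty\oplus\,\ell_1(\mathbb N)\Big)_{\ell_2} \] is SWKA and weakly sequentially complete, but it does not have property (*). Moreover, $X$ is not SWCG with respect to any Banach space $Z$ containing it (isometrically) as a subspace. Finally, property (*) is not preserved by countable $\ell_p$-sums for $1<p<\infty$, even if every summand is SWCG: the space $\ell_1(\mathbb N)$ is SWCG and has property (*), but for every $1<p<\infty$ the space $\big(\sum_{m=1}^\infty\oplus\,\ell_1(\mathbb N)\big)_{\ell_p}$ does not have property (*). -/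

import Mathlib

open Topology Pointwise
open scoped ENNReal

section Topological

/-- A topological space `T` is strongly `K`-analytic: there is an upper semicontinuous compact-valued
map `F` (with nonempty values) from the Baire space `ℕ → ℕ` to `T` whose values cover `T`, and every
compact subset of `T` is contained in one of the values. -/
def StronglyKAnalytic (T : Type*) [TopologicalSpace T] : Prop :=
  ∃ F : (ℕ → ℕ) → TopologicalSpace.NonemptyCompacts T,
    UpperHemicontinuous (fun σ => (F σ : Set T)) ∧
    (⋃ σ, (F σ : Set T)) = Set.univ ∧
    ∀ L : Set T, IsCompact L → ∃ σ, L ⊆ (F σ : Set T)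

end Topological

section Banach

variable (X : Type*) [NormedAddCommGroup X] [NormedSpace ℝ X]

/-- `X` is strongly weakly `K`-analytic: strongly `K`-analytic in its weak topology. -/
def SWKA : Prop := StronglyKAnalytic (WeakSpace ℝ X)

variable {X}

/-- A subset of a real normed space which is compact in the weak topology. -/
def IsWeaklyCompact (K : Set X) : Prop := IsCompact (toWeakSpace ℝ X '' K)

/-- A bounded set `M` is `ε`-weakly relatively compact if the weak-star closure of (the canonical
image of) `M` in the bidual is contained in `X + ε • B`, where `B` is the closed unit ball of the
bidual; that is, every point of that closure is at distance at most `ε` from a point of `X`. -/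
def IsEpsWeaklyRelCompact (ε : ℝ) (M : Set X) : Prop :=
  Bornology.IsBounded M ∧
  ∀ z : StrongDual ℝ (StrongDual ℝ X),
    StrongDual.toWeakDual z ∈
      closure ((fun x : X => StrongDual.toWeakDual (NormedSpace.inclusionInDoubleDual ℝ X x)) '' M) →
    ∃ x : X, ‖z - NormedSpace.inclusionInDoubleDual ℝ X x‖ ≤ ε

variable (X)

/-- Property (*): there are `1/p`-weakly relatively compact sets `M n p` (`p ≥ 1`) such that, for
every `p ≥ 1`, every weakly compact set is contained in some `M n p`. -/
def PropertyStar : Prop :=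
  ∃ M : ℕ → ℕ → Set X,
    (∀ n p : ℕ, 0 < p → IsEpsWeaklyRelCompact (1 / (p : ℝ)) (M n p)) ∧
    (∀ p : ℕ, 0 < p → ∀ L : Set X, IsWeaklyCompact L → ∃ n : ℕ, L ⊆ M n p)

/-- Weak sequential completeness: every weakly Cauchy sequence converges weakly. -/
def WeaklySeqComplete : Prop :=
  ∀ u : ℕ → X, (∀ f : StrongDual ℝ X, CauchySeq (fun n => f (u n))) →
    ∃ x : X, ∀ f : StrongDual ℝ X, Filter.Tendsto (fun n => f (u n)) Filter.atTop (𝓝 (f x))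

variable {X}

/-- `X`, regarded as a subspace of `Z` through the linear isometric embedding `ι`, is strongly weakly
compactly generated with respect to `Z`: there is a weakly compact `K ⊆ Z` such that every weakly
compact `L ⊆ X` is, for every `ε > 0`, contained in `n K + ε B_Z` for some `n ≥ 1`. -/
def IsSWCGWithRespectTo {Z : Type*} [NormedAddCommGroup Z] [NormedSpace ℝ Z] (ι : X →ₗᵢ[ℝ] Z) :
    Prop :=
  ∃ K : Set Z, IsWeaklyCompact K ∧
    ∀ L : Set X, IsWeaklyCompact L → ∀ ε : ℝ, 0 < ε →
      ∃ n : ℕ, 0 < n ∧ ι '' L ⊆ (n : ℝ) • K + Metric.closedBall (0 : Z) ε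

variable (X)

/-- `X` is strongly weakly compactly generated: it is so with respect to itself. -/
def SWCG : Prop := IsSWCGWithRespectTo (LinearIsometry.id : X →ₗᵢ[ℝ] X)

end Banach

/-- The real Banach space `ℓ₁(ℕ)`. -/
abbrev EllOne : Type := lp (fun _ : ℕ => ℝ) 1

/-- The `ℓ_p`-direct sum of countably many copies of `ℓ₁(ℕ)`. -/
abbrev SumEllOne (p : ℝ≥0∞) : Type := lp (fun _ : ℕ => EllOne) p

/-! Weak compactness is read off the coordinates. In `ℓ₁`, the Schur property gives weakly compact
sets uniformly small tails. In an `ℓ_p`-sum with `1 < p < ∞`, every functional is small on far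
tails, so bounded coordinatewise convergence implies weak convergence. Hence each `controlledSet p
σ` is weakly compact, and these sets absorb all weakly compact sets. Each constraint involves a
single value of `σ`, which gives upper semicontinuity. Weak sequential completeness follows from the
same two facts.

The negative results come from a diagonal argument. A set whose weak limits lie within `δ < 1` of
the space cannot contain all unit vectors of one copy of `ℓ₁` (`exists_unitVector_notMem`). Given
countably many such sets, choose in the `n`-th copy a unit vector missing from the `n`-th set. These
vectors are weakly null, so with `0` they form a weakly compact set contained in none of the given
sets. Both property (*) and SWCG with respect to a larger space would supply an absorbing countable
family of this kind.

For `ℓ₁` itself, a norm bound and a tail index describe weakly compact sets up to `ε`, which gives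
both positive statements. -/

/-! ### Tails in `ℓ_p`-sums. -/

section Tail

variable {E : ℕ → Type*} [∀ i, NormedAddCommGroup (E i)] [∀ i, NormedSpace ℝ (E i)]
  {p : ℝ≥0∞} [Fact (1 ≤ p)]

/-- The projection of an `ℓ_p`-sum onto the coordinates with index at least `N`. -/
noncomputable def tailCLM (E : ℕ → Type*) [∀ i, NormedAddCommGroup (E i)]
    [∀ i, NormedSpace ℝ (E i)] (p : ℝ≥0∞) [Fact (1 ≤ p)] (N : ℕ) : lp E p →L[ℝ] lp E p :=
  lp.mapCLM p (fun i => if i < N then 0 else ContinuousLinearMap.id ℝ (E i)) zero_le_one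
    (fun i => by
      split_ifs
      · simp
      · exact ContinuousLinearMap.norm_id_le)

theorem tailCLM_apply (N : ℕ) (x : lp E p) (i : ℕ) :
    tailCLM E p N x i = if i < N then 0 else x i := by
  unfold tailCLM
  rw [lp.mapCLM_apply_coe]
  split_ifs <;> rfl

theorem norm_tailCLM_le (N : ℕ) (x : lp E p) : ‖tailCLM E p N x‖ ≤ ‖x‖ := by
  simpa using (tailCLM E p N).le_of_opNorm_le (lp.norm_mapCLM_le p _ zero_le_one _) x

theorem tailCLM_tailCLM {N M : ℕ} (h : N ≤ M) (x : lp E p) :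
    tailCLM E p M (tailCLM E p N x) = tailCLM E p M x := by
  ext i
  simp only [tailCLM_apply]
  split_ifs <;> first | rfl | omega

theorem norm_tailCLM_anti {N M : ℕ} (h : N ≤ M) (x : lp E p) :
    ‖tailCLM E p M x‖ ≤ ‖tailCLM E p N x‖ := by
  rw [← tailCLM_tailCLM h]
  exact norm_tailCLM_le _ _

theorem sum_single_add_tailCLM (N : ℕ) (x : lp E p) :
    ∑ i ∈ Finset.range N, lp.single p i (x i) + tailCLM E p N x = x := by
  ext i
  simp only [lp.coeFn_add, Pi.add_apply, lp.coeFn_sum, Finset.sum_apply, lp.coeFn_single,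
    Finset.sum_pi_single, tailCLM_apply, Finset.mem_range]
  split_ifs <;> simp

theorem tendsto_tailCLM (hp : p ≠ ∞) (x : lp E p) :
    Filter.Tendsto (fun N => tailCLM E p N x) Filter.atTop (𝓝 0) := by
  have h := (lp.hasSum_single hp x).tendsto_sum_nat
  have h2 := (tendsto_const_nhds (x := x)).sub h
  rw [sub_self] at h2
  refine h2.congr fun N => ?_
  conv_lhs => lhs; rw [← sum_single_add_tailCLM N x]
  simp

theorem norm_sum_single_add_tailCLM_rpow (hp : p ≠ ∞) (N : ℕ) (v w : lp E p) :
    ‖∑ i ∈ Finset.range N, lp.single p i (v i) + tailCLM E p N w‖ ^ p.toReal =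
      ‖∑ i ∈ Finset.range N, lp.single p i (v i)‖ ^ p.toReal +
        ‖tailCLM E p N w‖ ^ p.toReal := by
  have hp0 : 0 < p.toReal :=
    ENNReal.toReal_pos (zero_lt_one.trans_le (Fact.out : 1 ≤ p)).ne' hp
  set f := ∑ i ∈ Finset.range N, lp.single p i (v i) + tailCLM E p N w with hf
  have hfi : ∀ i ∈ Finset.range N, f i = v i := by
    intro i hi
    simp only [hf, lp.coeFn_add, Pi.add_apply, lp.coeFn_sum, Finset.sum_apply, lp.coeFn_single,
      Finset.sum_pi_single, tailCLM_apply, if_pos hi, if_pos (Finset.mem_range.1 hi), add_zero]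
  have h1 := lp.norm_compl_sum_single hp0 f (Finset.range N)
  have e1 : ∑ i ∈ Finset.range N, lp.single p i (f i) =
      ∑ i ∈ Finset.range N, lp.single p i (v i) :=
    Finset.sum_congr rfl fun i hi => congrArg (lp.single p i) (hfi i hi)
  have e2 : ∑ i ∈ Finset.range N, ‖f i‖ ^ p.toReal = ∑ i ∈ Finset.range N, ‖v i‖ ^ p.toReal :=
    Finset.sum_congr rfl fun i hi => congrArg (fun z => ‖z‖ ^ p.toReal) (hfi i hi)
  rw [e1, e2, ← lp.norm_sum_single hp0 (fun i => v i)] at h1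
  have h2 : f - ∑ i ∈ Finset.range N, lp.single p i (v i) = tailCLM E p N w := by
    rw [hf]; abel
  rw [h2] at h1
  linarith

theorem norm_le_sum_add_norm_tailCLM (N : ℕ) (x : lp E p) :
    ‖x‖ ≤ ∑ i ∈ Finset.range N, ‖x i‖ + ‖tailCLM E p N x‖ := by
  conv_lhs => rw [← sum_single_add_tailCLM N x]
  refine (norm_add_le _ _).trans (add_le_add_left ((norm_sum_le _ _).trans ?_) _)
  refine Finset.sum_le_sum fun i _ => ?_
  rw [lp.norm_single (zero_lt_one.trans_le Fact.out)]

/-- For `1 < p < ∞` the finite partial sums of an `ℓ_p`-sum are shrinking. -/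
theorem exists_norm_apply_tailCLM_le (h1 : 1 < p) (hp : p ≠ ∞) (f : StrongDual ℝ (lp E p))
    {ε : ℝ} (hε : 0 < ε) : ∃ N, ∀ x, ‖f (tailCLM E p N x)‖ ≤ ε * ‖x‖ := by
  set r := p.toReal
  have hr : 1 < r := by
    have := (ENNReal.toReal_lt_toReal ENNReal.one_ne_top hp).2 h1
    simpa using this
  -- Adding `t` times a unit vector's tail to an almost norming vector supported before `N` raises
  -- the norm bound only from `1` to `1 + t ^ r`. As `r > 1`, a small `t` makes the cost `‖f‖ * t ^
  -- r` less than `t * (ε / 2)`; the other half of `t * ε` is the norming defect.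
  obtain ⟨t, ht0, ht1⟩ : ∃ t : ℝ, 0 < t ∧ ‖f‖ * t ^ (r - 1) < ε / 2 := by
    have : Filter.Tendsto (fun t : ℝ => ‖f‖ * t ^ (r - 1)) (𝓝[>] 0) (𝓝 (‖f‖ * 0 ^ (r - 1))) := by
      refine Filter.Tendsto.const_mul _ ?_
      exact ((Real.continuousAt_rpow_const 0 (r - 1) (Or.inr (by linarith))).tendsto).mono_left
        nhdsWithin_le_nhds
    rw [Real.zero_rpow (by linarith), mul_zero] at this
    obtain ⟨t, h1, h2⟩ := ((this.eventually (gt_mem_nhds (half_pos hε))).and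
      self_mem_nhdsWithin).exists
    exact ⟨t, h2, h1⟩
  have hδ : 0 < t * (ε / 2) := by positivity
  obtain ⟨v, hv1, hv2⟩ : ∃ v : lp E p, ‖v‖ ≤ 1 ∧ ‖f‖ - t * (ε / 2) < f v := by
    by_contra! hcon
    have : ‖f‖ ≤ max 0 (‖f‖ - t * (ε / 2)) := by
      refine f.opNorm_le_of_unit_norm (le_max_left _ _) fun x hx => ?_
      rw [Real.norm_eq_abs, abs_le']
      refine ⟨(hcon x hx.le).trans (le_max_right _ _), ?_⟩
      rw [← map_neg]
      exact (hcon (-x) (by rw [norm_neg, hx])).trans (le_max_right _ _)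
    rcases le_max_iff.1 this with h | h
    · have := hcon 0 (by simp)
      simp only [map_zero] at this
      linarith
    · linarith
  obtain ⟨N, hN⟩ : ∃ N, ‖f‖ - t * (ε / 2) < f (v - tailCLM E p N v) := by
    have h := (f.continuous.tendsto _).comp
      ((tendsto_const_nhds (x := v)).sub (tendsto_tailCLM hp v))
    rw [sub_zero] at h
    exact (h.eventually (lt_mem_nhds hv2)).exists
  have hv' : v - tailCLM E p N v = ∑ i ∈ Finset.range N, lp.single p i (v i) := by
    conv_lhs => lhs; rw [← sum_single_add_tailCLM N v]
    simp
  rw [hv'] at hN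
  set v' := ∑ i ∈ Finset.range N, lp.single p i (v i)
  have hv'1 : ‖v'‖ ^ r ≤ 1 := by
    have h3 := norm_sum_single_add_tailCLM_rpow hp N v v
    rw [sum_single_add_tailCLM] at h3
    have h4 : ‖v‖ ^ r ≤ 1 := Real.rpow_le_one (norm_nonneg _) hv1 (by linarith)
    have h5 : 0 ≤ ‖tailCLM E p N v‖ ^ r := Real.rpow_nonneg (norm_nonneg _) _
    linarith
  have key : ∀ x : lp E p, ‖x‖ = 1 → f (tailCLM E p N x) ≤ ε := by
    intro x hx
    have h3 := norm_sum_single_add_tailCLM_rpow hp N v (t • x)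
    have h4 : ‖tailCLM E p N (t • x)‖ ^ r ≤ t ^ r := by
      refine Real.rpow_le_rpow (norm_nonneg _) ?_ (by linarith)
      refine (norm_tailCLM_le _ _).trans ?_
      rw [norm_smul, hx, mul_one, Real.norm_eq_abs, abs_of_pos ht0]
    have htr : 0 ≤ t ^ r := Real.rpow_nonneg ht0.le _
    have h5 : ‖v' + tailCLM E p N (t • x)‖ ^ r ≤ (1 + t ^ r) ^ r := by
      refine (h3.le.trans (add_le_add hv'1 h4)).trans ?_
      exact Real.self_le_rpow_of_one_le (by linarith) hr.le
    have h6 : ‖v' + tailCLM E p N (t • x)‖ ≤ 1 + t ^ r :=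
      (Real.rpow_le_rpow_iff (norm_nonneg _) (by positivity) (by linarith)).1 h5
    have h7 : f v' + t * f (tailCLM E p N x) ≤ ‖f‖ * (1 + t ^ r) := by
      have := (le_abs_self _).trans (f.le_opNorm_of_le h6)
      simpa using this
    have h8 : t ^ r = t * t ^ (r - 1) := by
      rw [← Real.rpow_one_add' ht0.le (by linarith)]; congr 1; ring
    have h9 : t * f (tailCLM E p N x) ≤ t * ε := by
      have := mul_le_mul_of_nonneg_left ht1.le ht0.le
      rw [h8] at h7
      nlinarith
    exact le_of_mul_le_mul_left h9 ht0
  refine ⟨N, fun x => ?_⟩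
  refine ContinuousLinearMap.le_of_opNorm_le (f.comp (tailCLM E p N)) ?_ x
  refine ContinuousLinearMap.opNorm_le_of_unit_norm hε.le fun x hx => ?_
  rw [Real.norm_eq_abs, abs_le']
  refine ⟨key x hx, ?_⟩
  rw [← map_neg]
  exact key (-x) (by rw [norm_neg, hx])

/-- A family whose coordinates converge and whose tails are eventually uniformly small is Cauchy. -/
theorem cauchy_map_of_tailCLM {ι : Type*} {l : Filter ι} [l.NeBot] {v : ι → lp E p}
    (hc : ∀ j, ∃ c, Filter.Tendsto (fun i => v i j) l (𝓝 c))
    (ht : ∀ ε > 0, ∃ N, ∀ᶠ i in l, ‖tailCLM E p N (v i)‖ ≤ ε) : Cauchy (l.map v) := by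
  choose c hc using hc
  rw [Metric.cauchy_iff]
  refine ⟨inferInstance, fun ε hε => ?_⟩
  obtain ⟨N, hN⟩ := ht (ε / 8) (by positivity)
  have hs : ∀ᶠ i in l, ∑ j ∈ Finset.range N, ‖v i j - c j‖ < ε / 8 := by
    have : Filter.Tendsto (fun i => ∑ j ∈ Finset.range N, ‖v i j - c j‖) l
        (𝓝 (∑ j ∈ Finset.range N, ‖c j - c j‖)) :=
      tendsto_finsetSum _ fun j _ => ((hc j).sub_const _).norm
    simp only [sub_self, norm_zero, Finset.sum_const_zero] at this
    exact this.eventually (gt_mem_nhds (by positivity))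
  refine ⟨{x | ‖tailCLM E p N x‖ ≤ ε / 8 ∧ ∑ j ∈ Finset.range N, ‖x j - c j‖ < ε / 8},
    hN.and hs, ?_⟩
  rintro x ⟨hx1, hx2⟩ y ⟨hy1, hy2⟩
  rw [dist_eq_norm]
  refine (norm_le_sum_add_norm_tailCLM N _).trans_lt ?_
  have h1 : ‖tailCLM E p N (x - y)‖ ≤ ε / 8 + ε / 8 := by
    rw [map_sub]
    exact (norm_sub_le _ _).trans (add_le_add hx1 hy1)
  have h2 : ∑ j ∈ Finset.range N, ‖(x - y) j‖ ≤
      ∑ j ∈ Finset.range N, ‖x j - c j‖ + ∑ j ∈ Finset.range N, ‖y j - c j‖ := by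
    rw [← Finset.sum_add_distrib]
    refine Finset.sum_le_sum fun j _ => ?_
    have : (x - y) j = (x j - c j) - (y j - c j) := by simp
    rw [this]
    exact norm_sub_le _ _
  linarith

end Tail

/-! ### Weak convergence and weak compactness. -/

section Weak

variable {X Y : Type*} [NormedAddCommGroup X] [NormedSpace ℝ X] [NormedAddCommGroup Y]
  [NormedSpace ℝ Y]

theorem continuous_weakSpace_eval (f : StrongDual ℝ X) :
    Continuous fun w : WeakSpace ℝ X => f ((toWeakSpace ℝ X).symm w) :=
  WeakBilin.eval_continuous _ f

theorem tendsto_toWeakSpace_iff {ι : Type*} {l : Filter ι} {v : ι → X} {x : X} :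
    Filter.Tendsto (fun i => toWeakSpace ℝ X (v i)) l (𝓝 (toWeakSpace ℝ X x)) ↔
      ∀ f : StrongDual ℝ X, Filter.Tendsto (fun i => f (v i)) l (𝓝 (f x)) := by
  refine ⟨fun h f => ((continuous_weakSpace_eval f).tendsto _).comp h, fun h => ?_⟩
  refine (WeakBilin.tendsto_iff_forall_eval_tendsto _ ?_).2 h
  intro a b hab
  by_contra hne
  obtain ⟨f, hf⟩ := SeparatingDual.exists_ne_zero (R := ℝ) (sub_ne_zero.2 hne)
  apply hf
  rw [map_sub, sub_eq_zero]
  exact congrArg (fun g => g f) hab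

theorem isWeaklyCompact_of_ultrafilter {K : Set X}
    (h : ∀ U : Ultrafilter X, K ∈ U → ∃ x ∈ K, ∀ f : StrongDual ℝ X,
      Filter.Tendsto (fun y => f y) U (𝓝 (f x))) : IsWeaklyCompact K := by
  rw [IsWeaklyCompact, isCompact_iff_ultrafilter_le_nhds']
  intro U hU
  obtain ⟨x, hx, hf⟩ := h (U.map (toWeakSpace ℝ X).symm) (by
    rw [Ultrafilter.mem_map]
    convert hU using 1
    exact ((toWeakSpace ℝ X).toEquiv.image_eq_preimage_symm K).symm)
  refine ⟨_, ⟨x, hx, rfl⟩, ?_⟩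
  have := tendsto_toWeakSpace_iff.2 hf
  rw [Ultrafilter.coe_map, Filter.tendsto_map'_iff] at this
  simpa [Function.comp_def, Filter.Tendsto] using this

theorem IsWeaklyCompact.exists_tendsto {K : Set X} (hK : IsWeaklyCompact K) {ι : Type*}
    (U : Ultrafilter ι) {v : ι → X} (hv : ∀ᶠ i in (U : Filter ι), v i ∈ K) :
    ∃ x ∈ K, ∀ f : StrongDual ℝ X, Filter.Tendsto (fun i => f (v i)) U (𝓝 (f x)) := by
  obtain ⟨_, ⟨x, hx, rfl⟩, h⟩ := isCompact_iff_ultrafilter_le_nhds'.1 hK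
    (U.map fun i => toWeakSpace ℝ X (v i)) (by
      rw [Ultrafilter.mem_map]
      filter_upwards [hv] with i hi using ⟨_, hi, rfl⟩)
  exact ⟨x, hx, tendsto_toWeakSpace_iff.1 h⟩

theorem IsWeaklyCompact.image {K : Set X} (hK : IsWeaklyCompact K) (T : X →L[ℝ] Y) :
    IsWeaklyCompact (T '' K) := by
  have h := IsCompact.image hK (WeakSpace.map T).continuous
  rw [Set.image_image] at h
  rw [IsWeaklyCompact, Set.image_image]
  exact h

theorem exists_norm_le_of_weakly_bounded {ι : Type*} {v : ι → X}
    (h : ∀ f : StrongDual ℝ X, ∃ C, ∀ i, ‖f (v i)‖ ≤ C) : ∃ C, ∀ i, ‖v i‖ ≤ C := by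
  obtain ⟨C, hC⟩ := banach_steinhaus (g := fun i => NormedSpace.inclusionInDoubleDual ℝ X (v i)) h
  refine ⟨C, fun i => ?_⟩
  rw [← (NormedSpace.inclusionInDoubleDualLi (𝕜 := ℝ) (E := X)).norm_map]
  exact hC i

theorem IsWeaklyCompact.exists_norm_le {K : Set X} (hK : IsWeaklyCompact K) :
    ∃ C, ∀ x ∈ K, ‖x‖ ≤ C := by
  obtain ⟨C, hC⟩ := exists_norm_le_of_weakly_bounded (v := fun x : K => (x : X)) fun f => by
    obtain ⟨C, hC⟩ := (IsCompact.image hK (continuous_weakSpace_eval f)).isBounded.exists_norm_le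
    exact ⟨C, fun x => hC _ ⟨_, ⟨x, x.2, rfl⟩, rfl⟩⟩
  exact ⟨C, fun x hx => hC ⟨x, hx⟩⟩

/-- In the presence of countably many separating functionals, a weakly compact set is weakly
sequentially compact. -/
theorem IsWeaklyCompact.exists_subseq {K : Set X} (hK : IsWeaklyCompact K)
    (g : ℕ → StrongDual ℝ X) (hg : ∀ x y, (∀ j, g j x = g j y) → x = y) {u : ℕ → X}
    (hu : ∀ n, u n ∈ K) : ∃ x ∈ K, ∃ φ : ℕ → ℕ, StrictMono φ ∧
      ∀ f : StrongDual ℝ X, Filter.Tendsto (fun n => f (u (φ n))) Filter.atTop (𝓝 (f x)) := by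
  let S : Set (WeakSpace ℝ X) := toWeakSpace ℝ X '' K
  have : CompactSpace S := isCompact_iff_compactSpace.1 hK
  -- A continuous injection of a compact space into `ℕ → ℝ` is an embedding, so `S` is metrizable.
  let G : S → ℕ → ℝ := fun w j => g j ((toWeakSpace ℝ X).symm w)
  have hGc : Continuous G :=
    continuous_pi fun j => (continuous_weakSpace_eval (g j)).comp continuous_subtype_val
  have hGi : Function.Injective G := fun a b hab =>
    Subtype.ext ((toWeakSpace ℝ X).symm.injective (hg _ _ fun j => congrFun hab j))
  have := (hGc.isClosedEmbedding hGi).isEmbedding.metrizableSpace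
  obtain ⟨⟨_, x, hx, rfl⟩, φ, hφ, h⟩ := CompactSpace.tendsto_subseq
    (fun n => (⟨toWeakSpace ℝ X (u n), u n, hu n, rfl⟩ : S))
  exact ⟨x, hx, φ, hφ, tendsto_toWeakSpace_iff.1 ((continuous_subtype_val.tendsto _).comp h)⟩

end Weak

/-! ### The Schur property and uniform tails in `ℓ₁`. -/

section EllOne

theorem EllOne.hasSum_norm (x : EllOne) : HasSum (fun i => |x i|) ‖x‖ := by
  simpa using lp.hasSum_norm (by simp) x

/-- The functional on `ℓ₁` given by a sequence in the unit ball of `ℓ_∞`. -/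
noncomputable def EllOne.pairing (y : ℕ → Set.Icc (-1 : ℝ) 1) : StrongDual ℝ EllOne :=
  (lp.tsumCLM ℝ ℕ ℝ).comp
    (lp.mapCLM 1 (fun i => (y i : ℝ) • ContinuousLinearMap.id ℝ ℝ) zero_le_one fun i => by
      rw [norm_smul, Real.norm_eq_abs]
      exact mul_le_one₀ (abs_le.2 (y i).2) (norm_nonneg _) ContinuousLinearMap.norm_id_le)

theorem EllOne.pairing_apply (y : ℕ → Set.Icc (-1 : ℝ) 1) (x : EllOne) :
    EllOne.pairing y x = ∑' i, (y i : ℝ) * x i := by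
  simp [EllOne.pairing]

theorem EllOne.hasSum_pairing (y : ℕ → Set.Icc (-1 : ℝ) 1) (x : EllOne) :
    HasSum (fun i => (y i : ℝ) * x i) (EllOne.pairing y x) := by
  rw [EllOne.pairing_apply]
  refine Summable.hasSum (.of_norm_bounded (EllOne.hasSum_norm x).summable fun i => ?_)
  rw [norm_mul, Real.norm_eq_abs, Real.norm_eq_abs]
  exact mul_le_of_le_one_left (abs_nonneg _) (abs_le.2 (y i).2)

theorem EllOne.norm_pairing_apply_le (y : ℕ → Set.Icc (-1 : ℝ) 1) (x : EllOne) :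
    ‖EllOne.pairing y x‖ ≤ ‖x‖ := by
  refine (EllOne.hasSum_pairing y x).norm_le_of_bounded (EllOne.hasSum_norm x) fun i => ?_
  rw [norm_mul, Real.norm_eq_abs, Real.norm_eq_abs]
  exact mul_le_of_le_one_left (abs_nonneg _) (abs_le.2 (y i).2)

theorem EllOne.continuous_pairing (x : EllOne) :
    Continuous fun y : ℕ → Set.Icc (-1 : ℝ) 1 => EllOne.pairing y x := by
  simp_rw [EllOne.pairing_apply]
  refine continuous_tsum (fun i => by fun_prop) (EllOne.hasSum_norm x).summable fun i y => ?_
  rw [norm_mul, Real.norm_eq_abs, Real.norm_eq_abs]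
  exact mul_le_of_le_one_left (abs_nonneg _) (abs_le.2 (y i).2)

/-- The tail norm of a vector is controlled by the functionals from a cylinder set of signs. -/
theorem EllOne.norm_tailCLM_le_of_pairing {c : ℕ → Set.Icc (-1 : ℝ) 1} {N : ℕ} {x : EllOne} {ε : ℝ}
    (h : ∀ y : ℕ → Set.Icc (-1 : ℝ) 1, (∀ i < N, y i = c i) → |EllOne.pairing y x| ≤ ε) :
    ‖tailCLM _ 1 N x‖ ≤ ε := by
  -- Beyond `N`, use the signs of `x` and their opposites; before `N`, use `c` in both. The two
  -- pairings then differ by twice the tail norm.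
  let s : ℕ → Set.Icc (-1 : ℝ) 1 := fun i =>
    if 0 ≤ x i then ⟨1, by norm_num⟩ else ⟨-1, by norm_num⟩
  let s' : ℕ → Set.Icc (-1 : ℝ) 1 := fun i =>
    if 0 ≤ x i then ⟨-1, by norm_num⟩ else ⟨1, by norm_num⟩
  let y : ℕ → Set.Icc (-1 : ℝ) 1 := fun i => if i < N then c i else s i
  let y' : ℕ → Set.Icc (-1 : ℝ) 1 := fun i => if i < N then c i else s' i
  have h1 := h y fun i hi => if_pos hi
  have h2 := h y' fun i hi => if_pos hi
  have h3 := (EllOne.hasSum_pairing y x).sub (EllOne.hasSum_pairing y' x)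
  have h4 : EllOne.pairing y x - EllOne.pairing y' x = 2 * ‖tailCLM _ 1 N x‖ := by
    refine h3.unique (((EllOne.hasSum_norm (tailCLM _ 1 N x)).mul_left 2).congr_fun ?_)
    intro i
    rw [tailCLM_apply]
    by_cases hi : i < N
    · simp [y, y', hi]
    · by_cases hx : 0 ≤ x i
      · simp [y, y', s, s', hi, hx, abs_of_nonneg hx]; ring
      · simp [y, y', s, s', hi, hx, abs_of_neg (not_le.1 hx)]; ring
  have := abs_le.1 h1
  have := abs_le.1 h2
  linarith

/-- The Schur property: weakly Cauchy sequences in `ℓ₁` are norm Cauchy. -/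
theorem EllOne.cauchySeq_of_weakly {u : ℕ → EllOne}
    (hu : ∀ f : StrongDual ℝ EllOne, CauchySeq fun n => f (u n)) : CauchySeq u := by
  refine cauchy_map_of_tailCLM (fun j => ?_) fun ε hε => ?_
  · exact cauchySeq_tendsto_of_complete (hu (lp.evalCLM ℝ (fun _ : ℕ => ℝ) 1 j))
  -- Baire category in the compact cube: weak Cauchyness makes the closed sets `A m` cover it, so
  -- one contains a cylinder fixing finitely many coordinates. This controls the tails of `u n - u
  -- m` uniformly in `n ≥ m`.
  let A : ℕ → Set (ℕ → Set.Icc (-1 : ℝ) 1) := fun m =>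
    ⋂ n ≥ m, {y | |EllOne.pairing y (u n - u m)| ≤ ε / 2}
  have hA : ∀ m, IsClosed (A m) := fun m => isClosed_biInter fun n _ =>
    isClosed_le (EllOne.continuous_pairing _).abs continuous_const
  have hU : ⋃ m, A m = Set.univ := by
    refine Set.eq_univ_of_forall fun y => ?_
    obtain ⟨m, hm⟩ := Metric.cauchySeq_iff'.1 (hu (EllOne.pairing y)) (ε / 2) (half_pos hε)
    refine Set.mem_iUnion.2 ⟨m, Set.mem_iInter₂.2 fun n hn => ?_⟩
    have := hm n hn
    rw [Real.dist_eq, ← map_sub] at this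
    exact this.le
  have : Nonempty (ℕ → Set.Icc (-1 : ℝ) 1) := ⟨fun _ => ⟨0, by norm_num⟩⟩
  obtain ⟨m, c, hc⟩ := nonempty_interior_of_iUnion_of_closed hA hU
  obtain ⟨I, V, hV, hIV⟩ := isOpen_pi_iff.1 isOpen_interior c hc
  obtain ⟨N, hN⟩ : ∃ N, ∀ i ∈ I, i < N :=
    ⟨I.sup id + 1, fun i hi => Nat.lt_succ_of_le (Finset.le_sup (f := id) hi)⟩
  obtain ⟨N', hN'⟩ : ∃ N', ‖tailCLM _ 1 N' (u m)‖ < ε / 2 := by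
    have := (tendsto_tailCLM ENNReal.one_ne_top (u m)).norm
    rw [norm_zero] at this
    exact (this.eventually (gt_mem_nhds (half_pos hε))).exists
  refine ⟨max N N', Filter.eventually_atTop.2 ⟨m, fun n hn => ?_⟩⟩
  have h1 : ‖tailCLM _ 1 N (u n - u m)‖ ≤ ε / 2 := by
    refine EllOne.norm_tailCLM_le_of_pairing (c := c) fun y hy => ?_
    have : y ∈ A m := interior_subset (hIV fun i hi => by
      rw [hy i (hN i hi)]
      exact (hV i hi).2)
    exact Set.mem_iInter₂.1 this n hn
  have h2 := norm_tailCLM_anti (le_max_left N N') (u n - u m)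
  have h3 := norm_tailCLM_anti (le_max_right N N') (u m)
  have h4 : tailCLM _ 1 (max N N') (u n) =
      tailCLM _ 1 (max N N') (u n - u m) + tailCLM _ 1 (max N N') (u m) := by
    rw [map_sub]; abel
  rw [h4]
  exact (norm_add_le _ _).trans (by linarith)

/-- Otherwise some `u N` in `L` has `N`-th tail larger than `ε`. A weakly convergent subsequence
converges in norm by Schur, and the tails of its limit vanish. -/
theorem EllOne.exists_norm_tailCLM_le {L : Set EllOne} (hL : IsWeaklyCompact L) {ε : ℝ}
    (hε : 0 < ε) : ∃ N, ∀ x ∈ L, ‖tailCLM _ 1 N x‖ ≤ ε := by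
  by_contra! hcon
  choose u huL hu using hcon
  obtain ⟨x, -, φ, hφ, h⟩ := hL.exists_subseq (fun j => lp.evalCLM ℝ (fun _ : ℕ => ℝ) 1 j)
    (fun x y hxy => lp.ext (funext hxy)) huL
  obtain ⟨z, hz⟩ := cauchySeq_tendsto_of_complete
    (EllOne.cauchySeq_of_weakly fun f => (h f).cauchySeq)
  have h1 := (tendsto_tailCLM ENNReal.one_ne_top z).norm
  rw [norm_zero] at h1
  have h2 := (hz.sub_const z).norm
  rw [sub_self, norm_zero] at h2
  obtain ⟨n, hn1, hn2⟩ := (((h1.comp hφ.tendsto_atTop).eventually (gt_mem_nhds (half_pos hε))).and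
    (h2.eventually (gt_mem_nhds (half_pos hε)))).exists
  have h3 := hu (φ n)
  have h4 : tailCLM _ 1 (φ n) (u (φ n)) =
      tailCLM _ 1 (φ n) (u (φ n) - z) + tailCLM _ 1 (φ n) z := by
    rw [map_sub]; abel
  rw [h4] at h3
  have h5 := norm_tailCLM_le (φ n) (u (φ n) - z)
  have h6 := h3.trans_le (norm_add_le _ _)
  simp only [Function.comp_def] at hn1
  linarith

end EllOne

/-! ### Weak sequential completeness and strong weak `K`-analyticity of the sum. -/

section Sum

/-- A coordinatewise limit of a bounded family in an `ℓ_p`-sum belongs to the `ℓ_p`-sum. -/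
theorem exists_lp_of_coord {E : ℕ → Type*} [∀ i, NormedAddCommGroup (E i)] {p : ℝ≥0∞}
    [Fact (1 ≤ p)] (hp : p ≠ ∞) {ι : Type*} {l : Filter ι} [l.NeBot]
    {v : ι → lp E p} {x : ∀ m, E m} {C : ℝ} (hC : ∀ᶠ i in l, ‖v i‖ ≤ C)
    (hx : ∀ m, Filter.Tendsto (fun i => v i m) l (𝓝 (x m))) :
    ∃ y : lp E p, (∀ m, y m = x m) ∧ ‖y‖ ≤ C := by
  have hx' := tendsto_pi_nhds.2 hx
  exact ⟨⟨x, memℓp_gen' (lp.sum_rpow_le_of_tendsto hp hC hx')⟩, fun _ => rfl,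
    lp.norm_le_of_tendsto hC hx'⟩

variable {E : ℕ → Type*} [∀ i, NormedAddCommGroup (E i)] [∀ i, NormedSpace ℝ (E i)]
  {p : ℝ≥0∞} [Fact (1 ≤ p)]

/-- In an `ℓ_p`-sum with `1 < p < ∞`, a bounded family converging coordinatewise converges
weakly. -/
theorem tendsto_apply_of_coord (h1 : 1 < p) (hp : p ≠ ∞) {ι : Type*} {l : Filter ι}
    {v : ι → lp E p} {x : lp E p} {C : ℝ} (hC : ∀ᶠ i in l, ‖v i‖ ≤ C)
    (hx : ∀ m, Filter.Tendsto (fun i => v i m) l (𝓝 (x m))) (f : StrongDual ℝ (lp E p)) :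
    Filter.Tendsto (fun i => f (v i)) l (𝓝 (f x)) := by
  rw [Metric.tendsto_nhds]
  intro ε hε
  have hD : 0 < |C| + ‖x‖ + 1 := by positivity
  obtain ⟨N, hN⟩ := exists_norm_apply_tailCLM_le h1 hp f (ε := ε / 2 / (|C| + ‖x‖ + 1))
    (by positivity)
  have hs : Filter.Tendsto (fun i => ∑ m ∈ Finset.range N, f (lp.single p m (v i m - x m))) l
      (𝓝 (∑ m ∈ Finset.range N, f (lp.single p m (x m - x m)))) :=
    tendsto_finsetSum _ fun m _ =>
      ((f.comp (lp.singleContinuousLinearMap ℝ E p m)).continuous.tendsto _).comp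
        ((hx m).sub_const _)
  simp only [sub_self, lp.single_zero, map_zero, Finset.sum_const_zero] at hs
  filter_upwards [hC, (Metric.tendsto_nhds.1 hs) (ε / 2) (half_pos hε)] with i hi1 hi2
  rw [dist_zero_right] at hi2
  rw [dist_eq_norm, ← map_sub, ← sum_single_add_tailCLM N (v i - x), map_add, map_sum]
  refine (norm_add_le _ _).trans_lt ?_
  have h2 : ‖v i - x‖ ≤ |C| + ‖x‖ + 1 :=
    (norm_sub_le _ _).trans (by linarith [le_abs_self C])
  have h3 : ‖f (tailCLM E p N (v i - x))‖ ≤ ε / 2 := by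
    refine (hN _).trans ((mul_le_mul_of_nonneg_left h2 (by positivity)).trans_eq ?_)
    field_simp
  have h4 : ‖∑ m ∈ Finset.range N, f (lp.single p m ((v i - x) m))‖ < ε / 2 := hi2
  linarith

theorem weaklySeqComplete_sumEllOne (h1 : 1 < p) (hp : p ≠ ∞) :
    WeaklySeqComplete (SumEllOne p) := by
  intro u hu
  obtain ⟨C, hC⟩ := exists_norm_le_of_weakly_bounded fun f => by
    obtain ⟨C, hC⟩ := (hu f).isBounded_range.exists_norm_le
    exact ⟨C, fun i => hC _ ⟨i, rfl⟩⟩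
  have hcoord : ∀ m, ∃ c, Filter.Tendsto (fun n => u n m) Filter.atTop (𝓝 c) := fun m =>
    cauchySeq_tendsto_of_complete (EllOne.cauchySeq_of_weakly fun f =>
      hu (f.comp (lp.evalCLM ℝ (fun _ : ℕ => EllOne) p m)))
  choose c hc using hcoord
  obtain ⟨x, hx, -⟩ := exists_lp_of_coord hp (Filter.Eventually.of_forall hC) hc
  exact ⟨x, tendsto_apply_of_coord h1 hp (Filter.Eventually.of_forall hC)
    fun m => by rw [hx]; exact hc m⟩

/-- The vectors whose norm and whose coordinates' tails are controlled by `σ`. -/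
def controlledSet (p : ℝ≥0∞) [Fact (1 ≤ p)] (σ : ℕ → ℕ) : Set (SumEllOne p) :=
  {x | ‖x‖ ≤ σ 0 ∧
    ∀ m k, ‖tailCLM _ 1 (σ (Nat.pair m k + 1)) (x m)‖ ≤ 1 / ((k : ℝ) + 1)}

/-- Each constraint is required only eventually along `U`, with no uniformity over `m` and `k`. Thus
the same statement serves for compactness at fixed `σ` and for upper semicontinuity, where the
parameter varies and tends to `σ`. -/
theorem exists_tendsto_mem_controlledSet (h1 : 1 < p) (hp : p ≠ ∞) {ι : Type*} (U : Ultrafilter ι)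
    {v : ι → SumEllOne p} {σ : ℕ → ℕ} (hv0 : ∀ᶠ i in (U : Filter ι), ‖v i‖ ≤ σ 0)
    (hv : ∀ m k, ∀ᶠ i in (U : Filter ι),
      ‖tailCLM _ 1 (σ (Nat.pair m k + 1)) (v i m)‖ ≤ 1 / ((k : ℝ) + 1)) :
    ∃ x ∈ controlledSet p σ, ∀ f : StrongDual ℝ (SumEllOne p),
      Filter.Tendsto (fun i => f (v i)) U (𝓝 (f x)) := by
  have hp0 : p ≠ 0 := (zero_lt_one.trans h1).ne'
  have hcoord : ∀ m, ∃ c, Filter.Tendsto (fun i => v i m) U (𝓝 c) := by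
    intro m
    refine CompleteSpace.complete (cauchy_map_of_tailCLM (fun j => ?_) fun ε hε => ?_)
    · have hb : ∀ᶠ i in (U : Filter ι), v i m j ∈ Metric.closedBall (0 : ℝ) (σ 0) := by
        filter_upwards [hv0] with i hi
        rw [mem_closedBall_zero_iff]
        exact (lp.norm_apply_le_norm one_ne_zero _ j).trans
          ((lp.norm_apply_le_norm hp0 _ m).trans hi)
      obtain ⟨c, -, hc⟩ := (isCompact_closedBall (0 : ℝ) (σ 0)).ultrafilter_le_nhds'
        (U.map fun i => v i m j) hb
      exact ⟨c, hc⟩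
    · obtain ⟨k, hk⟩ := exists_nat_one_div_lt hε
      exact ⟨_, (hv m k).mono fun i hi => hi.trans hk.le⟩
  choose c hc using hcoord
  obtain ⟨x, hx, hxn⟩ := exists_lp_of_coord hp hv0 hc
  have hc' : ∀ m, Filter.Tendsto (fun i => v i m) U (𝓝 (x m)) := fun m => by
    rw [hx]; exact hc m
  refine ⟨x, ⟨hxn, fun m k => ?_⟩, tendsto_apply_of_coord h1 hp hv0 hc'⟩
  exact le_of_tendsto (((tailCLM _ 1 _).continuous.tendsto _).comp (hc' m)).norm (hv m k)

theorem exists_subset_controlledSet {L : Set (SumEllOne p)} (hL : IsWeaklyCompact L) :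
    ∃ σ, L ⊆ controlledSet p σ := by
  obtain ⟨C, hC⟩ := hL.exists_norm_le
  obtain ⟨n, hn⟩ := exists_nat_ge C
  have ht : ∀ m k : ℕ, ∃ N, ∀ x ∈ L, ‖tailCLM (fun _ : ℕ => ℝ) 1 N (x m)‖ ≤ 1 / ((k : ℝ) + 1) := by
    intro m k
    obtain ⟨N, hN⟩ := EllOne.exists_norm_tailCLM_le
      (hL.image (lp.evalCLM ℝ (fun _ : ℕ => EllOne) p m)) (Nat.one_div_pos_of_nat (n := k))
    exact ⟨N, fun x hx => hN _ ⟨x, hx, rfl⟩⟩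
  choose N hN using ht
  -- Index `0` stores the norm bound; the shifted indices store the tail bounds.
  refine ⟨fun i => Nat.casesOn i n fun j => N j.unpair.1 j.unpair.2, fun x hx =>
    ⟨(hC x hx).trans hn, fun m k => ?_⟩⟩
  simpa only [Nat.unpair_pair] using hN m k x hx

theorem isWeaklyCompact_singleton {X : Type*} [NormedAddCommGroup X] [NormedSpace ℝ X] (x : X) :
    IsWeaklyCompact {x} := by
  rw [IsWeaklyCompact, Set.image_singleton]
  exact isCompact_singleton

theorem isWeaklyCompact_controlledSet (h1 : 1 < p) (hp : p ≠ ∞) (σ : ℕ → ℕ) :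
    IsWeaklyCompact (controlledSet p σ) :=
  isWeaklyCompact_of_ultrafilter fun U hU =>
    exists_tendsto_mem_controlledSet h1 hp U (v := id) (Filter.mem_of_superset hU fun _ hx => hx.1)
      fun m k => Filter.mem_of_superset hU fun _ hx => hx.2 m k

theorem zero_mem_controlledSet (σ : ℕ → ℕ) : (0 : SumEllOne p) ∈ controlledSet p σ := by
  refine ⟨by simp, fun m k => ?_⟩
  simp only [lp.coeFn_zero, Pi.zero_apply, map_zero, norm_zero]
  positivity

theorem swka_sumEllOne (h1 : 1 < p) (hp : p ≠ ∞) : SWKA (SumEllOne p) := by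
  refine ⟨fun σ => ⟨⟨_, isWeaklyCompact_controlledSet h1 hp σ⟩,
    ⟨_, 0, zero_mem_controlledSet σ, rfl⟩⟩, ?_, ?_, ?_⟩
  -- Closed-set form: if values at parameters arbitrarily near `σ` meet the closed set `t`, so does
  -- the value at `σ`. An ultrafilter of pairs (parameter, point) gives the limit point; since `ℕ`
  -- is discrete, each coordinate of the parameter is eventually that of `σ`.
  · refine UpperHemicontinuous.of_frequently fun σ t ht hfr => ?_
    change ((toWeakSpace ℝ (SumEllOne p) '' controlledSet p σ) ∩ t).Nonempty
    let S : Set ((ℕ → ℕ) × SumEllOne p) :=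
      {q | q.2 ∈ controlledSet p q.1 ∧ toWeakSpace ℝ _ q.2 ∈ t}
    have hne : (Filter.comap Prod.fst (𝓝 σ) ⊓ Filter.principal S).NeBot := by
      rw [← Filter.frequently_mem_iff_neBot, Filter.frequently_comap]
      refine hfr.mono ?_
      rintro τ ⟨_, ⟨x, hx, rfl⟩, hxt⟩
      exact ⟨(τ, x), rfl, hx, hxt⟩
    let U := Ultrafilter.of (Filter.comap Prod.fst (𝓝 σ) ⊓ Filter.principal S)
    have hU : (U : Filter _) ≤ Filter.comap Prod.fst (𝓝 σ) ⊓ Filter.principal S :=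
      Ultrafilter.of_le _
    have hS : ∀ᶠ q in (U : Filter ((ℕ → ℕ) × SumEllOne p)), q ∈ S :=
      Filter.le_principal_iff.1 (hU.trans inf_le_right)
    have hσ : Filter.Tendsto Prod.fst (U : Filter ((ℕ → ℕ) × SumEllOne p)) (𝓝 σ) :=
      Filter.tendsto_iff_comap.2 (hU.trans inf_le_left)
    have hσi : ∀ i, ∀ᶠ q in (U : Filter ((ℕ → ℕ) × SumEllOne p)), q.1 i = σ i := fun i => by
      simpa [nhds_discrete] using (tendsto_pi_nhds.1 hσ i)
    obtain ⟨x, hx, hf⟩ := exists_tendsto_mem_controlledSet h1 hp U (v := Prod.snd) (σ := σ)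
      (by filter_upwards [hS, hσi 0] with q hq h0 using h0 ▸ hq.1.1)
      fun m k => by
        filter_upwards [hS, hσi (Nat.pair m k + 1)] with q hq h0 using h0 ▸ hq.1.2 m k
    exact ⟨_, ⟨x, hx, rfl⟩, ht.mem_of_tendsto (tendsto_toWeakSpace_iff.2 hf)
      (hS.mono fun q hq => hq.2)⟩
  · refine Set.eq_univ_of_forall fun w => ?_
    obtain ⟨σ, hσ⟩ := exists_subset_controlledSet
      (isWeaklyCompact_singleton ((toWeakSpace ℝ (SumEllOne p)).symm w))
    exact Set.mem_iUnion.2 ⟨σ, _, hσ rfl, LinearEquiv.apply_symm_apply _ _⟩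
  · intro L hL
    obtain ⟨σ, hσ⟩ := exists_subset_controlledSet (p := p)
      (L := (toWeakSpace ℝ (SumEllOne p)).symm '' L) (by
        rw [IsWeaklyCompact, Set.image_image]
        simpa using hL)
    exact ⟨σ, fun w hw => ⟨_, hσ ⟨w, hw, rfl⟩, LinearEquiv.apply_symm_apply _ _⟩⟩

end Sum

/-! ### Approximating weak limits by points of the space. -/

section WeakApprox

variable {X : Type*} [NormedAddCommGroup X] [NormedSpace ℝ X]

/-- Every weak ultrafilter limit of a sequence in `M` is within `δ` of an element of `X`. -/
def WeaklyApproximable (δ : ℝ) (M : Set X) : Prop :=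
  ∀ (U : Ultrafilter ℕ) (u : ℕ → X), (∀ i, u i ∈ M) →
    ∃ x : X, ∀ (f : StrongDual ℝ X) (c : ℝ),
      Filter.Tendsto (fun i => f (u i)) U (𝓝 c) → |c - f x| ≤ δ * ‖f‖

/-- Weak-star compactness of bidual balls turns the ultrafilter limit into a point of the weak-star
closure. -/
theorem IsEpsWeaklyRelCompact.weaklyApproximable {ε : ℝ} {M : Set X}
    (hM : IsEpsWeaklyRelCompact ε M) : WeaklyApproximable ε M := by
  intro U u hu
  obtain ⟨C, hC⟩ := hM.1.exists_norm_le
  let w : ℕ → WeakDual ℝ (StrongDual ℝ X) := fun i =>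
    StrongDual.toWeakDual (NormedSpace.inclusionInDoubleDual ℝ X (u i))
  obtain ⟨z, -, hz⟩ := (WeakDual.isCompact_closedBall (𝕜 := ℝ)
    (0 : StrongDual ℝ (StrongDual ℝ X)) C).ultrafilter_le_nhds' (U.map w) (by
      refine Ultrafilter.mem_map.2 (Filter.Eventually.of_forall fun i => ?_)
      change NormedSpace.inclusionInDoubleDual ℝ X (u i) ∈ Metric.closedBall 0 C
      refine (mem_closedBall_zero_iff (E := StrongDual ℝ (StrongDual ℝ X))).2 ?_
      exact (NormedSpace.double_dual_bound ℝ X (u i)).trans (hC _ (hu i)))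
  have hz' : Filter.Tendsto w U (𝓝 z) := hz
  obtain ⟨x, hx⟩ := hM.2 (WeakDual.toStrongDual z)
    (mem_closure_of_tendsto hz' (Filter.Eventually.of_forall fun i => ⟨u i, hu i, rfl⟩))
  refine ⟨x, fun f c hc => ?_⟩
  have h1 : Filter.Tendsto (fun i => f (u i)) U (𝓝 (z f)) :=
    ((WeakDual.eval_continuous f).tendsto z).comp hz'
  rw [tendsto_nhds_unique hc h1]
  exact ContinuousLinearMap.le_of_opNorm_le
    (WeakDual.toStrongDual z - NormedSpace.inclusionInDoubleDual ℝ X x) hx f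

/-- A point which functionals vanishing on `W` see as close to `0` is close to `W`. -/
theorem exists_mem_norm_sub_lt_of_forall_dual {Z : Type*} [NormedAddCommGroup Z] [NormedSpace ℝ Z]
    (W : Submodule ℝ Z) (z : Z) {r s : ℝ} (hrs : r < s)
    (h : ∀ g : StrongDual ℝ Z, ‖g‖ ≤ 1 → (∀ w ∈ W, g w = 0) → g z ≤ r) :
    ∃ w ∈ W, ‖z - w‖ < s := by
  -- The distance to `W` is the quotient norm; a norming functional there pulls back to one
  -- vanishing on `W`.
  obtain ⟨g, hg1, hg2⟩ := exists_dual_vector'' ℝ (W.mkQ z)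
  have h1 : ‖W.mkQ z‖ < s := by
    have h2 := h (g.comp W.mkQL) ?_ fun w hw => ?_
    · refine lt_of_le_of_lt ?_ hrs
      rw [show ‖W.mkQ z‖ = g (W.mkQ z) from hg2.symm]
      exact h2
    · refine ContinuousLinearMap.opNorm_le_bound _ zero_le_one fun y => ?_
      refine (g.le_of_opNorm_le hg1 _).trans ?_
      gcongr
      exact Submodule.Quotient.norm_mk_le W y
    · have : W.mkQL w = 0 := (Submodule.Quotient.mk_eq_zero W).2 hw
      rw [ContinuousLinearMap.comp_apply, this, map_zero]
  obtain ⟨m, hm1, hm2⟩ := Submodule.Quotient.norm_mk_lt (S := W) (W.mkQ z)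
    (sub_pos.2 h1)
  refine ⟨z - m, (Submodule.Quotient.eq W).1 hm1.symm, ?_⟩
  rw [sub_sub_cancel]
  linarith

/-- The limit `t • k₀` of the compact parts is within `ε` of the weak limit but may lie outside `X`.
Functionals vanishing on `X` are at most `ε` there, so a point of `X` lies within `2 * ε` of it; the
errors add up to `3 * ε`. -/
theorem weaklyApproximable_preimage_smul_add_closedBall {Z : Type*} [NormedAddCommGroup Z]
    [NormedSpace ℝ Z] (ι : X →ₗᵢ[ℝ] Z) {K : Set Z} (hK : IsWeaklyCompact K) (t : ℝ) {ε : ℝ}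
    (hε : 0 < ε) :
    WeaklyApproximable (3 * ε) {x | ι x ∈ t • K + Metric.closedBall (0 : Z) ε} := by
  intro U u hu
  have hu' : ∀ i, ∃ k ∈ K, ‖ι (u i) - t • k‖ ≤ ε := by
    intro i
    obtain ⟨_, ⟨k, hk, rfl⟩, b, hb, h⟩ := hu i
    refine ⟨k, hk, ?_⟩
    rw [← h]
    simpa using hb
  choose k hk hku using hu'
  obtain ⟨k₀, -, hk₀⟩ := hK.exists_tendsto U (Filter.Eventually.of_forall hk)
  have hlim : ∀ (g : StrongDual ℝ Z) (c : ℝ), Filter.Tendsto (fun i => g (ι (u i))) U (𝓝 c) →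
      |c - g (t • k₀)| ≤ ε * ‖g‖ := by
    intro g c hc
    have h1 : Filter.Tendsto (fun i => g (t • k i)) U (𝓝 (g (t • k₀))) := by
      simp only [map_smul]
      exact (hk₀ g).const_smul t
    refine le_of_tendsto (hc.sub h1).abs (Filter.Eventually.of_forall fun i => ?_)
    rw [← map_sub, mul_comm]
    exact g.le_opNorm_of_le (hku i)
  obtain ⟨_, ⟨x, rfl⟩, hx⟩ := exists_mem_norm_sub_lt_of_forall_dual (LinearMap.range ι.toLinearMap)
    (t • k₀) (r := ε) (s := 2 * ε) (by linarith) fun g hg1 hg2 => by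
      have h1 := hlim g 0 (by
        simp only [fun i => hg2 (ι (u i)) ⟨u i, rfl⟩]
        exact tendsto_const_nhds)
      rw [zero_sub, abs_neg] at h1
      exact (le_abs_self _).trans (h1.trans (mul_le_of_le_one_right hε.le hg1))
  refine ⟨x, fun f c hc => ?_⟩
  obtain ⟨g, hg1, hg2⟩ := exists_extension_norm_eq (LinearMap.range ι.toLinearMap)
    (f.comp (ι.equivRange.symm.toContinuousLinearEquiv : _ →L[ℝ] X))
  have hgf : ∀ y, g (ι y) = f y := fun y => by
    have := hg1 (ι.equivRange y)
    simpa using this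
  have hgn : ‖g‖ ≤ ‖f‖ := by
    rw [hg2]
    refine ContinuousLinearMap.opNorm_le_bound _ (norm_nonneg _) fun y => ?_
    refine (f.le_opNorm _).trans_eq ?_
    congr 1
    exact ι.equivRange.symm.norm_map y
  have h1 := hlim g c (by simpa only [hgf] using hc)
  have h2 : |g (t • k₀) - f x| ≤ 2 * ε * ‖g‖ := by
    rw [← hgf, ← map_sub, mul_comm]
    exact g.le_opNorm_of_le hx.le
  calc |c - f x| ≤ |c - g (t • k₀)| + |g (t • k₀) - f x| := abs_sub_le _ _ _
    _ ≤ 3 * ε * ‖g‖ := by linarith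
    _ ≤ 3 * ε * ‖f‖ := by gcongr

end WeakApprox

/-! ### The diagonal argument with unit vectors. -/

section UnitVectors

variable {p : ℝ≥0∞} [Fact (1 ≤ p)]

/-- The `j`-th unit vector of the `n`-th copy of `ℓ₁`. -/
noncomputable def SumEllOne.unitVector (p : ℝ≥0∞) (n j : ℕ) : SumEllOne p :=
  lp.single p n (lp.single 1 j (1 : ℝ))

theorem EllOne.tailCLM_single {N j : ℕ} (h : N ≤ j) :
    tailCLM (fun _ : ℕ => ℝ) 1 N (lp.single 1 j (1 : ℝ)) = lp.single 1 j (1 : ℝ) := by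
  ext i
  rw [tailCLM_apply]
  split_ifs with hi
  · exact (lp.single_apply_ne (E := fun _ : ℕ => ℝ) 1 j 1 (by omega)).symm
  · rfl

/-- Summing the entries of the `n`-th coordinate from `N` on is a functional of norm at most `1`.
Its limit along the unit vectors is `1` for every `N`, whereas its value at any fixed `x` tends to
`0` as `N` grows. -/
theorem exists_unitVector_notMem {δ : ℝ} (hδ : δ < 1) {M : Set (SumEllOne p)}
    (hM : WeaklyApproximable δ M) (n : ℕ) : ∃ j, SumEllOne.unitVector p n j ∉ M := by
  by_contra! hcon
  obtain ⟨x, hx⟩ := hM (Filter.hyperfilter ℕ) _ hcon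
  have hp0 : p ≠ 0 := (zero_lt_one.trans_le (Fact.out : 1 ≤ p)).ne'
  let s : StrongDual ℝ EllOne := EllOne.pairing fun _ => ⟨1, by norm_num⟩
  have hsj : ∀ j, s (lp.single 1 j (1 : ℝ)) = 1 := by
    intro j
    rw [EllOne.pairing_apply, tsum_eq_single j fun i hi => ?_]
    · rw [lp.single_apply_self, one_mul]
    · exact (congrArg _ (lp.single_apply_ne (E := fun _ : ℕ => ℝ) 1 j 1 hi)).trans (mul_zero _)
  let f : ℕ → StrongDual ℝ (SumEllOne p) := fun N =>
    (s.comp (tailCLM _ 1 N)).comp (lp.evalCLM ℝ (fun _ : ℕ => EllOne) p n)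
  have hf : ∀ N (y : SumEllOne p), f N y = s (tailCLM _ 1 N (y n)) := fun _ _ => rfl
  have hfn : ∀ N (y : SumEllOne p), ‖f N y‖ ≤ ‖tailCLM _ 1 N (y n)‖ := fun N y =>
    EllOne.norm_pairing_apply_le _ _
  have hf1 : ∀ N, ‖f N‖ ≤ 1 := by
    refine fun N => ContinuousLinearMap.opNorm_le_bound _ zero_le_one fun y => ?_
    rw [one_mul]
    exact (hfn N y).trans ((norm_tailCLM_le _ _).trans (lp.norm_apply_le_norm hp0 y n))
  -- The maximum covers negative `δ`, for which `δ * ‖f N‖` need not be at most `δ`.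
  have h1 : ∀ N, |1 - f N x| ≤ max δ 0 := by
    intro N
    refine (hx (f N) 1 ?_).trans ?_
    · refine Filter.Tendsto.mono_left ?_ Nat.hyperfilter_le_atTop
      refine tendsto_const_nhds.congr' ?_
      filter_upwards [Filter.eventually_ge_atTop N] with j hj
      rw [hf, SumEllOne.unitVector, lp.single_apply_self, EllOne.tailCLM_single hj, hsj]
    · exact (mul_le_mul_of_nonneg_right (le_max_left _ _) (norm_nonneg _)).trans
        (mul_le_of_le_one_right (le_max_right _ _) (hf1 N))
  have h2 : Filter.Tendsto (fun N => f N x) Filter.atTop (𝓝 0) := by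
    refine squeeze_zero_norm (fun N => hfn N x) ?_
    rw [← norm_zero (E := EllOne)]
    exact (tendsto_tailCLM ENNReal.one_ne_top (x n)).norm
  have h3 := le_of_tendsto (h2.const_sub 1).abs (Filter.Eventually.of_forall h1)
  rw [sub_zero, abs_one] at h3
  exact absurd h3 (not_le.2 (max_lt hδ zero_lt_one))

/-- With one unit vector per copy, each coordinate is eventually zero, so the bounded sequence is
weakly null. -/
theorem isWeaklyCompact_insert_zero_range_unitVector (h1 : 1 < p) (hp : p ≠ ∞) (σ : ℕ → ℕ) :
    IsWeaklyCompact (insert 0 (Set.range fun n => SumEllOne.unitVector p n (σ n))) := by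
  have hlim : Filter.Tendsto (fun n => toWeakSpace ℝ _ (SumEllOne.unitVector p n (σ n)))
      Filter.atTop (𝓝 (toWeakSpace ℝ (SumEllOne p) 0)) := by
    refine tendsto_toWeakSpace_iff.2 (tendsto_apply_of_coord h1 hp (C := 1)
      (Filter.Eventually.of_forall fun n => ?_) fun m => ?_)
    · rw [SumEllOne.unitVector, lp.norm_single (zero_lt_one.trans h1), lp.norm_single zero_lt_one,
        norm_one]
    · refine tendsto_const_nhds.congr' ?_
      filter_upwards [Filter.eventually_gt_atTop m] with n hn
      rw [SumEllOne.unitVector, lp.single_apply_ne p n _ hn.ne]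
      rfl
  have := hlim.isCompact_insert_range
  rw [IsWeaklyCompact, Set.image_insert_eq, ← Set.range_comp]
  exact this

/-- Countably many `δ`-approximable sets with `δ < 1` do not absorb the weakly compact subsets of
the `ℓ_p`-sum of copies of `ℓ₁`. -/
theorem exists_isWeaklyCompact_forall_not_subset (h1 : 1 < p) (hp : p ≠ ∞) {δ : ℝ} (hδ : δ < 1)
    {M : ℕ → Set (SumEllOne p)} (hM : ∀ n, WeaklyApproximable δ (M n)) :
    ∃ L, IsWeaklyCompact L ∧ ∀ n, ¬ L ⊆ M n := by
  choose σ hσ using fun n => exists_unitVector_notMem hδ (hM n) n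
  exact ⟨_, isWeaklyCompact_insert_zero_range_unitVector h1 hp σ,
    fun n hn => hσ n (hn (Set.mem_insert_of_mem _ ⟨n, rfl⟩))⟩

theorem not_propertyStar_sumEllOne (h1 : 1 < p) (hp : p ≠ ∞) : ¬ PropertyStar (SumEllOne p) := by
  rintro ⟨M, hM, hL⟩
  obtain ⟨L, hLc, hLn⟩ := exists_isWeaklyCompact_forall_not_subset h1 hp
    (δ := 1 / ((2 : ℕ) : ℝ)) (by norm_num) fun n => (hM n 2 two_pos).weaklyApproximable
  obtain ⟨n, hn⟩ := hL 2 two_pos L hLc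
  exact hLn n hn

theorem not_isSWCGWithRespectTo_sumEllOne (h1 : 1 < p) (hp : p ≠ ∞) {Z : Type*}
    [NormedAddCommGroup Z] [NormedSpace ℝ Z] (ι : SumEllOne p →ₗᵢ[ℝ] Z) :
    ¬ IsSWCGWithRespectTo ι := by
  rintro ⟨K, hK, h⟩
  -- Any `ε < 1 / 3` would do, since only `3 * ε < 1` is needed.
  obtain ⟨L, hLc, hLn⟩ := exists_isWeaklyCompact_forall_not_subset h1 hp
    (δ := 3 * (1 / 6)) (by norm_num)
    fun n : ℕ => weaklyApproximable_preimage_smul_add_closedBall ι hK (n : ℝ) (ε := 1 / 6)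
      (by norm_num)
  obtain ⟨n, -, hn⟩ := h L hLc (1 / 6) (by norm_num)
  exact hLn n fun x hx => hn ⟨x, hx, rfl⟩

end UnitVectors

/-! ### `ℓ₁` is SWCG and has property (*). -/

section EllOnePositive

/-- The vector `(2⁻ᵏ)ₖ` of `ℓ₁`. -/
noncomputable def EllOne.geometric : EllOne :=
  ⟨fun k => (1 / 2 : ℝ) ^ k, memℓp_gen (by simpa using summable_geometric_two)⟩

theorem EllOne.geometric_apply (k : ℕ) : EllOne.geometric k = (1 / 2 : ℝ) ^ k := rfl

/-- The vectors of `ℓ₁` dominated by `(2⁻ᵏ)ₖ`. -/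
def EllOne.dominatedSet : Set EllOne := {x | ∀ k, |x k| ≤ (1 / 2 : ℝ) ^ k}

/-- Domination by a summable sequence makes tails uniformly small, so ultrafilters on the set even
converge in norm. -/
theorem EllOne.isWeaklyCompact_dominatedSet : IsWeaklyCompact EllOne.dominatedSet := by
  refine isWeaklyCompact_of_ultrafilter fun U hU => ?_
  have hU' : ∀ᶠ x in (U : Filter EllOne), x ∈ EllOne.dominatedSet := hU
  have hc : Cauchy ((U : Filter EllOne).map id) := by
    refine cauchy_map_of_tailCLM (fun j => ?_) fun ε hε => ?_
    · obtain ⟨c, -, hc⟩ := (isCompact_closedBall (0 : ℝ) ((1 / 2) ^ j)).ultrafilter_le_nhds'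
        (U.map fun x => x j) (hU'.mono fun x hx => mem_closedBall_zero_iff.2 (hx j))
      exact ⟨c, hc⟩
    · have h := (tendsto_tailCLM ENNReal.one_ne_top EllOne.geometric).norm
      rw [norm_zero] at h
      obtain ⟨N, hN⟩ := (h.eventually (gt_mem_nhds hε)).exists
      refine ⟨N, hU'.mono fun x hx => (lp.norm_mono one_ne_zero fun i => ?_).trans hN.le⟩
      rw [tailCLM_apply, tailCLM_apply]
      split_ifs
      · exact le_rfl
      · rw [EllOne.geometric_apply, Real.norm_of_nonneg (by positivity : (0 : ℝ) ≤ (1 / 2) ^ i)]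
        exact hx i
  obtain ⟨x, hx⟩ := CompleteSpace.complete hc
  have hx' : Filter.Tendsto id (U : Filter EllOne) (𝓝 x) := hx
  refine ⟨x, fun k => ?_, fun f => (f.continuous.tendsto x).comp hx'⟩
  exact le_of_tendsto (((lp.evalCLM ℝ (fun _ : ℕ => ℝ) 1 k).continuous.tendsto x).comp hx').abs
    (hU'.mono fun y hy => hy k)

theorem swcg_ellOne : SWCG EllOne := by
  refine ⟨_, EllOne.isWeaklyCompact_dominatedSet, fun L hL ε hε => ?_⟩
  obtain ⟨C, hC⟩ := hL.exists_norm_le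
  obtain ⟨N, hN⟩ := EllOne.exists_norm_tailCLM_le hL hε
  -- Before `N` the dominating sequence is at least `2⁻ᴺ`, so the factor `C * 2 ^ N` absorbs entries
  -- bounded by `C`.
  obtain ⟨n, hn⟩ := exists_nat_ge (C * 2 ^ N)
  have hn1 : (0 : ℝ) < (n + 1 : ℕ) := by positivity
  refine ⟨n + 1, Nat.succ_pos n, ?_⟩
  rintro _ ⟨x, hx, rfl⟩
  refine ⟨_, ⟨((n + 1 : ℕ) : ℝ)⁻¹ • (x - tailCLM _ 1 N x), fun k => ?_, rfl⟩, tailCLM _ 1 N x,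
    mem_closedBall_zero_iff.2 (hN x hx), ?_⟩
  · rw [lp.coeFn_smul, Pi.smul_apply, lp.coeFn_sub, Pi.sub_apply, tailCLM_apply]
    split_ifs with hk
    · rw [sub_zero, smul_eq_mul, abs_mul, abs_of_pos (inv_pos.2 hn1), inv_mul_le_iff₀ hn1]
      have h1 : |x k| ≤ C := (lp.norm_apply_le_norm one_ne_zero x k).trans (hC x hx)
      have h2 : (1 / 2 : ℝ) ^ N ≤ (1 / 2) ^ k :=
        pow_le_pow_of_le_one (by norm_num) (by norm_num) hk.le
      have h3 : C = C * 2 ^ N * (1 / 2) ^ N := by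
        rw [mul_assoc, ← mul_pow]; norm_num
      refine h1.trans (h3.le.trans ?_)
      have h4 : C * 2 ^ N ≤ (n + 1 : ℕ) := hn.trans (by push_cast; linarith)
      gcongr
    · rw [sub_self, smul_zero, abs_zero]
      positivity
  · simp only [smul_inv_smul₀ hn1.ne', LinearIsometry.id_apply, sub_add_cancel]

theorem EllOne.comp_tailCLM (f : StrongDual ℝ EllOne) (N : ℕ) :
    f.comp (tailCLM _ 1 N) = f - ∑ k ∈ Finset.range N,
      f (lp.single 1 k (1 : ℝ)) • lp.evalCLM ℝ (fun _ : ℕ => ℝ) 1 k := by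
  ext x
  have h := congrArg f (sum_single_add_tailCLM N x)
  rw [map_add, map_sum] at h
  have h2 : ∀ k, f (lp.single 1 k (x k)) = f (lp.single 1 k (1 : ℝ)) * x k := fun k => by
    rw [mul_comm, ← smul_eq_mul, ← map_smul, ← lp.single_smul, smul_eq_mul, mul_one]
  simp only [h2] at h
  have h3 : (f - ∑ k ∈ Finset.range N,
      f (lp.single 1 k (1 : ℝ)) • lp.evalCLM ℝ (fun _ : ℕ => ℝ) 1 k) x =
      f x - ∑ k ∈ Finset.range N, f (lp.single 1 k (1 : ℝ)) * x k := by
    rw [sub_apply, sum_apply]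
    rfl
  rw [h3, ContinuousLinearMap.comp_apply]
  linarith

/-- The approximant keeps the first `N` coordinates of `z`. By `EllOne.comp_tailCLM` the error at
`f` is the value of `z` at `f` composed with the tail projection, and its bound by `ε * ‖f‖` passes
to the weak-star closure. -/
theorem EllOne.isEpsWeaklyRelCompact (a ε : ℝ) (hε : 0 ≤ ε) (N : ℕ) :
    IsEpsWeaklyRelCompact ε {x : EllOne | ‖x‖ ≤ a ∧ ‖tailCLM _ 1 N x‖ ≤ ε} := by
  refine ⟨isBounded_iff_forall_norm_le.2 ⟨a, fun x hx => hx.1⟩, fun z hz => ?_⟩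
  refine ⟨∑ k ∈ Finset.range N, z (lp.evalCLM ℝ (fun _ : ℕ => ℝ) 1 k) • lp.single 1 k (1 : ℝ),
    ContinuousLinearMap.opNorm_le_bound _ hε fun f => ?_⟩
  have h1 : (z - NormedSpace.inclusionInDoubleDual ℝ EllOne
      (∑ k ∈ Finset.range N, z (lp.evalCLM ℝ (fun _ : ℕ => ℝ) 1 k) • lp.single 1 k (1 : ℝ))) f =
      z (f.comp (tailCLM _ 1 N)) := by
    rw [EllOne.comp_tailCLM, sub_apply, NormedSpace.dual_def, map_sub,
      map_sum, map_sum]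
    simp only [map_smul, smul_eq_mul, mul_comm]
  rw [h1]
  have hcl : IsClosed {w : WeakDual ℝ (StrongDual ℝ EllOne) |
      ‖w (f.comp (tailCLM _ 1 N))‖ ≤ ε * ‖f‖} :=
    isClosed_le (WeakDual.eval_continuous _).norm continuous_const
  refine closure_minimal ?_ hcl hz
  rintro _ ⟨x, hx, rfl⟩
  change ‖f (tailCLM _ 1 N x)‖ ≤ ε * ‖f‖
  rw [mul_comm]
  exact f.le_opNorm_of_le hx.2

theorem propertyStar_ellOne : PropertyStar EllOne := by
  -- The index `n` encodes a norm bound and a tail index.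
  refine ⟨fun n q => {x | ‖x‖ ≤ n.unpair.1 ∧ ‖tailCLM _ 1 n.unpair.2 x‖ ≤ 1 / (q : ℝ)},
    fun n q _ => EllOne.isEpsWeaklyRelCompact _ _ (by positivity) _, fun q hq L hL => ?_⟩
  obtain ⟨C, hC⟩ := hL.exists_norm_le
  obtain ⟨a, ha⟩ := exists_nat_ge C
  obtain ⟨N, hN⟩ := EllOne.exists_norm_tailCLM_le hL (ε := 1 / (q : ℝ)) (by positivity)
  refine ⟨Nat.pair a N, fun x hx => ?_⟩
  simp only [Nat.unpair_pair]
  exact ⟨(hC x hx).trans ha, hN x hx⟩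

end EllOnePositive

/-! ### The main theorem. -/

theorem mainTheorem6 :
    SWKA (SumEllOne 2) ∧
    WeaklySeqComplete (SumEllOne 2) ∧
    ¬ PropertyStar (SumEllOne 2) ∧
    (∀ (Z : Type*) [NormedAddCommGroup Z] [NormedSpace ℝ Z] [CompleteSpace Z]
      (ι : SumEllOne 2 →ₗᵢ[ℝ] Z), ¬ IsSWCGWithRespectTo ι) ∧
    (SWCG EllOne ∧ PropertyStar EllOne ∧
      ∀ (p : ℝ≥0∞) [Fact (1 ≤ p)], 1 < p → p ≠ ∞ → ¬ PropertyStar (SumEllOne p)) := by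
  have h1 : (1 : ℝ≥0∞) < 2 := ENNReal.one_lt_two
  have h2 : (2 : ℝ≥0∞) ≠ ∞ := ENNReal.ofNat_ne_top
  exact ⟨swka_sumEllOne h1 h2, weaklySeqComplete_sumEllOne h1 h2,
    not_propertyStar_sumEllOne h1 h2,
    fun _ _ _ _ ι => not_isSWCGWithRespectTo_sumEllOne h1 h2 ι,
    swcg_ellOne, propertyStar_ellOne, fun _ _ hp hp' => not_propertyStar_sumEllOne hp hp'⟩
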